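/- **Notation.** A mask is a real sequence $a\in\ell_1(\mathbb Z)$, with symbol $a(z)=\sum_{k\in\mathbb Z}a_kz^k$ for $z\in\mathbb T=\{z\in\mathbb C:|z|=1\}$, even part $a_{ev}=(a_{2k})_{k\in\mathbb Z}$, and Toeplitz matrix $A_a=(a_{j-k})_{j,k\in\mathbb Z}$ acting on $\ell_2(\mathbb Z)$, with operator norm $\|A_a\|_2$. A mask $g$ is the inverse $a^{-1}$ of $a$ if $a(z)g(z)=1$ for all $z\in\mathbb T$. Let $(S_ac)_k=\sum_{\ell}a_{k-2\ell}c_\ell$ be the subdivision operator of $a$ and $(D_gc)_k=\sum_\ell g_\ell c_{2(k-\ell)}$ the decimation operator of $g$, both on $\ell_\infty(\mathbb Z)$. $S_a$ is even-reversible if $a_{ev}(z)\ne0$ for all $z\in\mathbb T$; $D_g$ is an even-inverse of $S_a$ if $g$ is a mask and $(c-S_aD_gc)_{2k}=0$ for all $c\in\ell_\infty(\mathbb Z)$ and $k\in\mathbb Z$. For $x\in\mathbb R$, $\binom{x}{j}=\frac{x(x-1)\cdots(x-j+1)}{j!}$. The pseudo-spline mask $\alpha^{n,\nu}$ is the finitely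 supported mask with symbol $$\alpha^{n,\nu}(z)=\frac{z^{-\lfloor n/2\rfloor}(1+z)^n}{2^{n-1}}\sum_{j=0}^{\nu}\binom{n/2+j-1}{j}\Big(\frac12-\frac{z+z^{-1}}4\Big)^j ,$$ and the spline mask of order $m\ge1$ is the one with symbol $2^{1-m}z^{-\lfloor m/2\rfloor}(1+z)^m$. **Theorem.** Let $n,\nu\ge0$ be integers with $0\le\nu\le\lfloor n/2\rfloor-1$, and let $\alpha=\alpha^{n,\nu}$. 1. $\alpha_{ev}(1)=1$ and $\|A_{\alpha_{ev}}\|_2=\max_{z\in\mathbb T}|\alpha_{ev}(z)|=1$. 2. The inverse $\gamma=(\alpha_{ev})^{-1}$ exists, is unique, and $\gamma(1)=1$. 3. $\displaystyle \|A_\gamma\|_2=\frac{2^{\lfloor (n-1)/2\rfloor+\nu}}{\sum_{j=0}^{\nu}\binom{n/2+\nu}{j}}$. 4. The elements of $\gamma$ decay exponentially: there are $K>0$ and $r\in(0,1)$ with $|\gamma_\ell|\le K r^{|\ell|}$ for all $\ell\in\mathbb Z$. Consequently, the pseudo-spline subdivision operator $S_\alpha$ is even-reversible, with even-inverse $D_\gamma$;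 and for every $m\ge1$ the subdivision operator of the spline mask of order $m$ is even-reversible and has an even-inverse. -/

import Mathlib

open scoped ENNReal LaurentPolynomial

noncomputable section

/-- A mask: a real bi-infinite sequence that belongs to `ℓ¹(ℤ)`. -/
def IsMask (a : ℤ → ℝ) : Prop :=
  Memℓp (E := fun _ : ℤ => ℝ) a 1

/-- The symbol `a(z) = ∑ₖ aₖ zᵏ`. For a mask the series converges absolutely on `|z| = 1`. -/
def symbol (a : ℤ → ℝ) (z : ℂ) : ℂ :=
  ∑' k : ℤ, (a k : ℂ) * z ^ k

/-- Downsampling `(c ↓ 2)ₖ = c₂ₖ`; applied to a mask this is its even part. -/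
def downsample (c : ℤ → ℝ) : ℤ → ℝ :=
  fun k => c (2 * k)

/-- The convolution `(a * c)ₖ = ∑ₗ aₗ cₖ₋ₗ`. -/
def convolve (a c : ℤ → ℝ) : ℤ → ℝ :=
  fun k => ∑' l : ℤ, a l * c (k - l)

/-- The subdivision operator `(S_a c)ₖ = ∑ₗ aₖ₋₂ₗ cₗ`. -/
def subdivide (a c : ℤ → ℝ) : ℤ → ℝ :=
  fun k => ∑' l : ℤ, a (k - 2 * l) * c l

/-- The decimation operator `D_g c = g * (c ↓ 2)`. -/
def decimate (g c : ℤ → ℝ) : ℤ → ℝ :=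
  convolve g (downsample c)

/-- The subdivision operator `S_a` is even-reversible: `a_ev(z) ≠ 0` for all `|z| = 1`. -/
def IsEvenReversible (a : ℤ → ℝ) : Prop :=
  ∀ z : ℂ, ‖z‖ = 1 → symbol (downsample a) z ≠ 0

/-- `D_g`, with `g` a mask, is the even-inverse of `S_a`:
`[(Id - S_a D_g) c] ↓ 2 = 0` for every `c ∈ ℓ^∞(ℤ)`. -/
def IsEvenInverse (a g : ℤ → ℝ) : Prop :=
  IsMask g ∧ ∀ c : ℤ → ℝ, Memℓp (E := fun _ : ℤ => ℝ) c ∞ →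
    downsample (c - subdivide a (decimate g c)) = 0

/-- `g` is the inverse `a⁻¹` of the mask `a`: it is a mask with `g(z) = 1 / a(z)` on `|z| = 1`. -/
def IsInverseMask (a g : ℤ → ℝ) : Prop :=
  IsMask g ∧ ∀ z : ℂ, ‖z‖ = 1 → symbol a z * symbol g z = 1

/-- The bi-infinite Toeplitz matrix `A_a = (a_{j-k})_{j,k}` is a bounded operator on `ℓ²(ℤ)`
and its operator norm is `r`. -/
def HasToeplitzNorm (a : ℤ → ℝ) (r : ℝ) : Prop :=
  ∃ A : lp (fun _ : ℤ => ℝ) 2 →L[ℝ] lp (fun _ : ℤ => ℝ) 2,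
    (∀ (c : lp (fun _ : ℤ => ℝ) 2) (j : ℤ), HasSum (fun k : ℤ => a (j - k) * c k) (A c j)) ∧
      ‖A‖ = r

/-- Exponential decay of the elements of a sequence. -/
def DecaysExponentially (g : ℤ → ℝ) : Prop :=
  ∃ K r : ℝ, 0 < K ∧ 0 < r ∧ r < 1 ∧ ∀ l : ℤ, |g l| ≤ K * r ^ l.natAbs

/-- The Laurent polynomial
`z^{-⌊n/2⌋} (1 + z)ⁿ / 2ⁿ⁻¹ * ∑_{j ≤ ν} C(n/2 + j - 1, j) (1/2 - (z + z⁻¹) / 4)ʲ`,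
where `n/2` is a real number and `C` the generalized binomial coefficient. -/
def pseudoSplineSymbol (n ν : ℕ) : ℝ[T;T⁻¹] :=
  LaurentPolynomial.C ((2 : ℝ) ^ (1 - (n : ℤ))) * LaurentPolynomial.T (-((n / 2 : ℕ) : ℤ)) *
    (1 + LaurentPolynomial.T 1) ^ n *
    ∑ j ∈ Finset.range (ν + 1),
      LaurentPolynomial.C (Ring.choose ((n : ℝ) / 2 + (j : ℝ) - 1) j) *
        (LaurentPolynomial.C (1 / 2) -
          LaurentPolynomial.C (1 / 4) * (LaurentPolynomial.T 1 + LaurentPolynomial.T (-1))) ^ j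

/-- The pseudo-spline mask `α^{n,ν}`: the coefficients of its symbol. -/
def pseudoSplineMask (n ν : ℕ) : ℤ → ℝ :=
  fun k => (pseudoSplineSymbol n ν).coeff k

/-- The mask of the spline subdivision operator of order `m`, with symbol
`z^{-⌊m/2⌋} (1 + z)ᵐ / 2ᵐ⁻¹`. -/
def splineMask (m : ℕ) : ℤ → ℝ :=
  fun k => (LaurentPolynomial.C ((2 : ℝ) ^ (1 - (m : ℤ))) *
    LaurentPolynomial.T (-((m / 2 : ℕ) : ℤ)) * (1 + LaurentPolynomial.T 1) ^ m : ℝ[T;T⁻¹]).coeff k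

end

/-! Put `s = n/2`, `y = sin² φ`, and let `Q` be the Taylor polynomial of degree `ν` of `(1 -
y)^(-s)`. At `e^{2iφ}` the pseudo-spline symbol equals `2 e^{iφ(n mod 2)} cosⁿ φ · Q(y)`. Replacing
`z` by `-z` shifts `φ` by `π/2` and swaps `y` with `1 - y`. Averaging the two values gives the even
symbol at `e^{4iφ}`. For even `n` its modulus, and for odd `n` its squared modulus (the two halves
are then orthogonal in `ℂ`), is `h(y) + h(1 - y)`, where `h` is `(1 - y)^{n/2} Q(y)`, respectively
the square of that.

Up to one monomial, `Q` solves the differential equation of `(1 - y)^(-s)`, so `h' = -D` with `D`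
explicit. The restriction on `ν` gives `D(1 - y) ≤ D(y)` for `0 ≤ y ≤ 1/2`. So the sum decreases on
`[0, 1/2]`, from `1` at `y = 0` (that is, `z = 1`) to its minimum at `y = 1/2` (`z = -1`); Pascal's
rule evaluates `Q(1/2)`. The key lemmas are `exists_hasDerivAt_truncatedBinomial`,
`reflected_sum_bounds` and `two_pow_mul_truncatedBinomial_half`.

A Toeplitz norm is the maximal modulus of the symbol. Parseval gives `≤`; the converse is needed
only at `z = ±1`, where real test vectors suffice. The inverse exists and decays because the even
symbol is a Laurent polynomial without zeros on the circle, hence a product of factors each with a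
geometric inverse. It yields an even-inverse because the even part of `S_a D_g c` is `a_ev * g * (c
↓ 2)`. -/

/-! ### Masks as Fourier coefficients of their symbols. -/

theorem norm_fourier_apply {T : ℝ} (k : ℤ) (x : AddCircle T) : ‖fourier k x‖ = 1 := by
  rw [fourier_apply]
  exact Circle.norm_coe _

open MeasureTheory AddCircle in
theorem fourierCoeff_tsum {a : ℤ → ℂ} (ha : Summable fun k => ‖a k‖) (n : ℤ) :
    fourierCoeff (fun x : UnitAddCircle => ∑' k, a k * fourier k x) n = a n := by
  have h := hasSum_integral_of_summable_integral_norm (μ := haarAddCircle (T := 1))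
    (F := fun k (x : UnitAddCircle) => fourier (-n) x • (a k * fourier k x))
    (fun k => (Continuous.integrable_of_hasCompactSupport (by fun_prop)
      (HasCompactSupport.of_compactSpace _)))
    (by simpa only [norm_smul, norm_mul, norm_fourier_apply, one_mul, mul_one, integral_const,
      probReal_univ, one_smul] using ha)
  have h1 : ∀ k, ∫ x, fourier (-n) x • (a k * fourier k x) ∂(haarAddCircle (T := 1)) =
      if k = n then a n else 0 := fun k => by
    have := fourierCoeff.const_mul (T := 1) (fourier k) (a k) n
    rw [fourierCoeff_fourier, fourierCoeff] at this
    rw [this]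
    rcases eq_or_ne k n with rfl | h
    · simp
    · simp [h, h.symm]
  simp only [h1] at h
  have h2 := h.unique (hasSum_ite_eq n (a n))
  rw [← h2, fourierCoeff]
  simp only [smul_eq_mul, tsum_mul_left]

theorem fourierCoeff_fourier_mul {T : ℝ} [Fact (0 < T)] (F : AddCircle T → ℂ) (k n : ℤ) :
    fourierCoeff (fun x => fourier k x * F x) n = fourierCoeff F (n - k) := by
  simp only [fourierCoeff, smul_eq_mul]
  congr 1 with x
  rw [← mul_assoc, ← fourier_add]
  congr 3
  ring

open MeasureTheory AddCircle in
theorem ContinuousMap.hasSum_sq_fourierCoeff {T : ℝ} [Fact (0 < T)] (F : C(AddCircle T, ℂ)) :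
    HasSum (fun n => ‖fourierCoeff F n‖ ^ 2) (∫ x, ‖F x‖ ^ 2 ∂haarAddCircle) := by
  have h := _root_.hasSum_sq_fourierCoeff (ContinuousMap.toLp (E := ℂ) 2 haarAddCircle ℂ F)
  simp only [fourierCoeff_toLp] at h
  convert! h using 1
  refine integral_congr_ae ?_
  filter_upwards [ContinuousMap.coeFn_toLp (p := 2) (𝕜 := ℂ) haarAddCircle F] with x hx
  rw [hx]

theorem IsMask.summable_norm {a : ℤ → ℝ} (ha : IsMask a) : Summable fun k => ‖a k‖ := by
  simpa using Memℓp.summable (p := 1) (by simp) ha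

theorem isMask_of_summable_norm {a : ℤ → ℝ} (ha : Summable fun k => ‖a k‖) : IsMask a :=
  memℓp_gen (by simpa using ha)

theorem fourier_eq_toCircle_zpow {T : ℝ} (k : ℤ) (x : AddCircle T) :
    fourier k x = (AddCircle.toCircle x : ℂ) ^ k := by
  rw [fourier_apply, AddCircle.toCircle_zsmul, Circle.coe_zpow]

theorem symbol_toCircle (a : ℤ → ℝ) (x : UnitAddCircle) :
    symbol a (AddCircle.toCircle x) = ∑' k, (a k : ℂ) * fourier k x := by
  simp only [symbol, fourier_eq_toCircle_zpow]

theorem IsMask.fourierCoeff_symbol {a : ℤ → ℝ} (ha : IsMask a) (n : ℤ) :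
    fourierCoeff (fun x : UnitAddCircle => symbol a (AddCircle.toCircle x)) n = a n := by
  simp only [symbol_toCircle]
  exact fourierCoeff_tsum (by simpa using ha.summable_norm) n

/-- The entries are the Fourier coefficients of the symbol. Uniqueness of inverses and the identity
`a * γ = δ` both rest on this. -/
theorem IsMask.ext_symbol {a b : ℤ → ℝ} (ha : IsMask a) (hb : IsMask b)
    (h : ∀ z : ℂ, ‖z‖ = 1 → symbol a z = symbol b z) : a = b := by
  funext n
  have := ha.fourierCoeff_symbol n
  rw [funext fun x : UnitAddCircle => h (AddCircle.toCircle x) (Circle.norm_coe _),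
    hb.fourierCoeff_symbol n] at this
  exact_mod_cast this.symm

theorem IsMask.continuous_symbol {a : ℤ → ℝ} (ha : IsMask a) :
    Continuous fun x : UnitAddCircle => symbol a (AddCircle.toCircle x) := by
  simp only [symbol_toCircle]
  refine continuous_tsum (fun k => by fun_prop) ha.summable_norm fun k x => ?_
  rw [norm_mul, norm_fourier_apply, Complex.norm_real, mul_one]

/-! ### Norms of Toeplitz operators on `ℓ²`. -/

open MeasureTheory AddCircle in
theorem fourierCoeff_sum_smul_fourier_mul {T : ℝ} [Fact (0 < T)] (S : Finset ℤ) (c : ℤ → ℂ)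
    (F : C(AddCircle T, ℂ)) (n : ℤ) :
    fourierCoeff (⇑((∑ k ∈ S, c k • fourier k) * F : C(AddCircle T, ℂ))) n =
      ∑ k ∈ S, c k * fourierCoeff (⇑F) (n - k) := by
  have h : (⇑((∑ k ∈ S, c k • fourier k) * F : C(AddCircle T, ℂ)) : AddCircle T → ℂ) =
      ∑ k ∈ S, fun x => c k * (fourier k x * F x) := by
    ext x
    rw [ContinuousMap.mul_apply, ContinuousMap.sum_apply, Finset.sum_apply, Finset.sum_mul]
    exact Finset.sum_congr rfl fun k _ => mul_assoc _ _ _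
  rw [h, fourierCoeff.sum, Finset.sum_apply]
  · refine Finset.sum_congr rfl fun k _ => ?_
    rw [fourierCoeff.const_mul, fourierCoeff_fourier_mul]
  · intro k _
    exact (c k • (fourier k * F)).continuous.integrable_of_hasCompactSupport
      (HasCompactSupport.of_compactSpace _)

open MeasureTheory AddCircle in
/-- The convolution of a finitely supported sequence by a mask, bounded in `ℓ²`. -/
theorem IsMask.sum_sq_convolve_le {a : ℤ → ℝ} (ha : IsMask a) {M : ℝ}
    (hM : ∀ z : ℂ, ‖z‖ = 1 → ‖symbol a z‖ ≤ M) (c : ℤ → ℝ) (S J : Finset ℤ) :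
    ∑ j ∈ J, (∑ k ∈ S, a (j - k) * c k) ^ 2 ≤ M ^ 2 * ∑ k ∈ S, c k ^ 2 := by
  obtain ⟨F, hF⟩ : ∃ F : C(UnitAddCircle, ℂ), ∀ x, F x = symbol a (toCircle x) :=
    ⟨⟨_, ha.continuous_symbol⟩, fun _ => rfl⟩
  obtain ⟨P, hPdef⟩ : ∃ P : C(UnitAddCircle, ℂ), P = ∑ k ∈ S, (c k : ℂ) • fourier k := ⟨_, rfl⟩
  have hFc : ∀ n, fourierCoeff F n = a n := fun n => by
    rw [funext hF, ha.fourierCoeff_symbol]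
  have hGc : ∀ n, fourierCoeff (⇑(P * F)) n = ((∑ k ∈ S, a (n - k) * c k : ℝ) : ℂ) := by
    intro n
    rw [hPdef, fourierCoeff_sum_smul_fourier_mul]
    simp only [hFc, Complex.ofReal_sum, Complex.ofReal_mul, mul_comm]
  have hPc : ∀ n, fourierCoeff P n = if n ∈ S then (c n : ℂ) else 0 := by
    intro n
    have h0 : (fourier 0 : C(UnitAddCircle, ℂ)) = 1 := by
      ext x
      exact fourier_zero
    rw [← mul_one P, ← h0, hPdef, fourierCoeff_sum_smul_fourier_mul (T := 1)]
    simp [fourierCoeff_fourier (T := 1), Pi.single_apply, sub_eq_zero]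
  have hP := P.hasSum_sq_fourierCoeff
  have hG := (P * F).hasSum_sq_fourierCoeff
  have hP2 : ∫ x, ‖P x‖ ^ 2 ∂haarAddCircle = ∑ k ∈ S, c k ^ 2 := by
    rw [← hP.tsum_eq, tsum_eq_sum (s := S) (fun k hk => by simp [hPc, hk])]
    exact Finset.sum_congr rfl fun k hk => by simp [hPc, hk]
  -- The inner sums are Fourier coefficients of `P * F`. Bessel's inequality, the bound `M` on `F`
  -- and Parseval for `P` conclude.
  calc ∑ j ∈ J, (∑ k ∈ S, a (j - k) * c k) ^ 2 = ∑ j ∈ J, ‖fourierCoeff (⇑(P * F)) j‖ ^ 2 := by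
        refine Finset.sum_congr rfl fun j _ => ?_
        rw [hGc, Complex.norm_real, Real.norm_eq_abs, sq_abs]
    _ ≤ ∫ x, ‖(P * F) x‖ ^ 2 ∂haarAddCircle := sum_le_hasSum _ (fun _ _ => by positivity) hG
    _ ≤ ∫ x, M ^ 2 * ‖P x‖ ^ 2 ∂haarAddCircle := by
        refine integral_mono_of_nonneg (.of_forall fun _ => by positivity) ?_ (.of_forall fun x => ?_)
        · exact (Continuous.integrable_of_hasCompactSupport (by fun_prop)
            (HasCompactSupport.of_compactSpace _))
        · have : ‖F x‖ ≤ M := hF x ▸ hM _ (Circle.norm_coe _)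
          simp only [ContinuousMap.mul_apply, norm_mul, mul_pow]
          rw [mul_comm]
          gcongr
    _ = M ^ 2 * ∑ k ∈ S, c k ^ 2 := by rw [integral_const_mul, hP2]

theorem lp.sum_sq_le (c : lp (fun _ : ℤ => ℝ) 2) (S : Finset ℤ) :
    ∑ k ∈ S, c k ^ 2 ≤ ‖c‖ ^ 2 := by
  simpa using lp.sum_rpow_le_norm_rpow (p := 2) (by simp) c S

theorem IsMask.summable_toeplitz {a : ℤ → ℝ} (ha : IsMask a) (c : lp (fun _ : ℤ => ℝ) 2) (j : ℤ) :
    Summable fun k : ℤ => a (j - k) * c k := by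
  have h1 : Summable fun k : ℤ => ‖a (j - k)‖ * ‖c‖ :=
    ((Equiv.subLeft j).summable_iff.2 ha.summable_norm).mul_right _
  refine .of_norm_bounded h1 fun k => ?_
  rw [norm_mul]
  gcongr
  exact lp.norm_apply_le_norm (by simp) c k

theorem IsMask.sum_sq_toeplitz_le {a : ℤ → ℝ} (ha : IsMask a) {M : ℝ}
    (hM : ∀ z : ℂ, ‖z‖ = 1 → ‖symbol a z‖ ≤ M) (c : lp (fun _ : ℤ => ℝ) 2) (J : Finset ℤ) :
    ∑ j ∈ J, (∑' k, a (j - k) * c k) ^ 2 ≤ M ^ 2 * ‖c‖ ^ 2 := by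
  have : Filter.Tendsto (fun S : Finset ℤ => ∑ j ∈ J, (∑ k ∈ S, a (j - k) * c k) ^ 2)
      Filter.atTop (nhds (∑ j ∈ J, (∑' k, a (j - k) * c k) ^ 2)) :=
    tendsto_finsetSum _ fun j _ => (ha.summable_toeplitz c j).hasSum.pow 2
  refine le_of_tendsto this (.of_forall fun S => (ha.sum_sq_convolve_le hM c S J).trans ?_)
  gcongr
  exact lp.sum_sq_le c S

theorem IsMask.exists_toeplitz {a : ℤ → ℝ} (ha : IsMask a) {M : ℝ} (hM0 : 0 ≤ M)
    (hM : ∀ z : ℂ, ‖z‖ = 1 → ‖symbol a z‖ ≤ M) :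
    ∃ A : lp (fun _ : ℤ => ℝ) 2 →L[ℝ] lp (fun _ : ℤ => ℝ) 2,
      (∀ (c : lp (fun _ : ℤ => ℝ) 2) (j : ℤ), HasSum (fun k : ℤ => a (j - k) * c k) (A c j)) ∧
        ‖A‖ ≤ M := by
  let L : lp (fun _ : ℤ => ℝ) 2 →ₗ[ℝ] lp (fun _ : ℤ => ℝ) 2 :=
    { toFun := fun c => ⟨fun j => ∑' k, a (j - k) * c k, memℓp_gen' (C := M ^ 2 * ‖c‖ ^ 2)
        fun J => by simpa using ha.sum_sq_toeplitz_le hM c J⟩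
      map_add' := fun c d => by
        ext j
        simp only [lp.coeFn_add, Pi.add_apply, mul_add]
        exact (ha.summable_toeplitz c j).tsum_add (ha.summable_toeplitz d j)
      map_smul' := fun t c => by
        ext j
        simp only [lp.coeFn_smul, Pi.smul_apply, smul_eq_mul, RingHom.id_apply, ← tsum_mul_left]
        exact tsum_congr fun k => by ring }
  refine ⟨L.mkContinuous M fun c => ?_, fun c j => (ha.summable_toeplitz c j).hasSum,
    L.mkContinuous_norm_le hM0 _⟩
  refine lp.norm_le_of_forall_sum_le (by simp) (by positivity) fun J => ?_
  simpa [mul_pow, L] using ha.sum_sq_toeplitz_le hM c J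

-- Enlarging the square from `N` to `N + 1` adds a border on which `j - k` takes each value in `[-N,
-- N]` once. The double sum is therefore a sum of symmetric partial sums of `b`, and Cesàro's
-- theorem applies.
open Filter Topology in
theorem tendsto_mean_sum_sub {b : ℤ → ℝ} (hb : Summable b) :
    Tendsto (fun N : ℕ => (N : ℝ)⁻¹ * ∑ j ∈ Finset.range N, ∑ k ∈ Finset.range N, b (j - k))
      atTop (𝓝 (∑' m, b m)) := by
  let s : ℕ → ℝ := fun N =>
    ∑ i ∈ Finset.range (N + 1), b (-i) + ∑ i ∈ Finset.range N, b (i + 1)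
  have hsum : ∀ N, ∑ j ∈ Finset.range N, ∑ k ∈ Finset.range N, b (j - k) =
      ∑ n ∈ Finset.range N, s n := by
    intro N
    induction N with
    | zero => simp
    | succ N ih =>
      rw [Finset.sum_range_succ _ N, Finset.sum_range_succ s, ← ih]
      simp only [Finset.sum_range_succ _ N, Finset.sum_add_distrib, s]
      rw [← Finset.sum_range_reflect (fun i : ℕ => b (i + 1)),
        ← Finset.sum_range_reflect (fun i : ℕ => b (-i)) N]
      have h1 : ∀ i ∈ Finset.range N, b (-((N - 1 - i : ℕ) : ℤ) - 1) = b (i - N) := by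
        intro i hi
        have := Finset.mem_range.1 hi
        congr 1
        omega
      have h2 : ∀ i ∈ Finset.range N, b (((N - 1 - i : ℕ) : ℤ) + 1) = b (N - i) := by
        intro i hi
        have := Finset.mem_range.1 hi
        congr 1
        omega
      have h3 : ∑ i ∈ Finset.range N, b (i - N) + b 0 =
          ∑ i ∈ Finset.range N, b (-((N - 1 - i : ℕ) : ℤ)) + b (-N) := by
        rw [Finset.sum_range_reflect (fun i : ℕ => b (-i)) N, ← Finset.sum_range_succ,
          Finset.sum_range_succ', ← Finset.sum_range_reflect (fun i : ℕ => b (-((i + 1 : ℕ) : ℤ)))]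
        congr 1
        refine Finset.sum_congr rfl fun i hi => ?_
        have := Finset.mem_range.1 hi
        congr 1
        omega
      rw [Finset.sum_congr rfl h2]
      have h4 : b ((N : ℤ) - N) = b 0 := by simp
      linarith
  have hn : Summable fun m => b (-m) := (Equiv.neg ℤ).summable_iff.2 hb
  have h1 : Summable fun i : ℕ => b (-i) := hn.comp_injective Nat.cast_injective
  have h2 : Summable fun i : ℕ => b (i + 1) :=
    hb.comp_injective (i := fun i : ℕ => (i : ℤ) + 1) fun i j h => by simpa using h
  have hs : Tendsto s atTop (𝓝 (∑' m, b m)) := by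
    have h3 := tsum_of_nat_of_neg_add_one (f := fun m => b (-m)) h1 (by simpa using h2)
    rw [(Equiv.neg ℤ).tsum_eq b |>.symm]
    simp only [Equiv.neg_apply]
    rw [h3]
    simp only [neg_neg]
    exact ((tendsto_add_atTop_iff_nat 1).2 h1.hasSum.tendsto_sum_nat).add h2.hasSum.tendsto_sum_nat
  simpa only [hsum] using hs.cesaro

theorem symbol_eq_tsum_mul_zpow {a : ℤ → ℝ} (ε : ℝ) :
    symbol a (ε : ℂ) = ((∑' m, a m * ε ^ m : ℝ) : ℂ) := by
  rw [symbol, Complex.ofReal_tsum]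
  push_cast
  rfl

open Filter Topology in
/-- A Toeplitz operator is bounded below by the values of the symbol at `±1`. -/
theorem IsMask.le_norm_toeplitz {a : ℤ → ℝ} (ha : IsMask a) {ε : ℝ} (hε : |ε| = 1)
    (A : lp (fun _ : ℤ => ℝ) 2 →L[ℝ] lp (fun _ : ℤ => ℝ) 2)
    (hA : ∀ (c : lp (fun _ : ℤ => ℝ) 2) (j : ℤ), HasSum (fun k : ℤ => a (j - k) * c k) (A c j)) :
    ‖symbol a (ε : ℂ)‖ ≤ ‖A‖ := by
  have hε0 : ε ≠ 0 := by
    rintro rfl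
    simp at hε
  have hinv : ε⁻¹ = ε := by
    rcases eq_or_eq_neg_of_abs_eq hε with rfl | rfl <;> norm_num
  have habs : ∀ k : ℤ, |ε ^ k| = 1 := fun k => by rw [abs_zpow, hε, one_zpow]
  have hb : Summable fun m => a m * ε ^ m := by
    refine .of_norm ?_
    simpa only [Real.norm_eq_abs, abs_mul, habs, mul_one] using ha.summable_norm
  have hlim := (tendsto_mean_sum_sub hb).abs
  rw [symbol_eq_tsum_mul_zpow, Complex.norm_real]
  refine le_of_tendsto hlim (.of_forall fun N => ?_)
  let s : Finset ℤ := (Finset.range N).map Nat.castEmbedding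
  have hcard : (s.card : ℝ) = N := by simp [s]
  -- A truncation of the formal eigenvector `ε^k`, with squared norm `N`. Pairing it with `A c`
  -- gives `N` times the Cesàro mean of `a m * ε ^ m`, which Cauchy–Schwarz bounds by `N * ‖A‖`.
  let c : lp (fun _ : ℤ => ℝ) 2 := ∑ k ∈ s, lp.single 2 k (ε ^ k)
  have hc : ‖c‖ ^ 2 = N := by
    have := lp.norm_sum_single (p := 2) (by simp) (fun k : ℤ => ε ^ k) s
    simp only [Real.norm_eq_abs, habs] at this
    simpa [c, hcard] using this
  have hAs : ∀ (k : ℤ) (x : ℝ) (j : ℤ), A (lp.single 2 k x) j = a (j - k) * x := by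
    intro k x j
    refine (hA _ j).unique ?_
    convert! hasSum_ite_eq k (a (j - k) * x) using 2 with i
    rcases eq_or_ne i k with rfl | h
    · simp
    · simp [h]
  have hAc : ∀ j, A c j = ∑ k ∈ s, a (j - k) * ε ^ k := by
    intro j
    simp only [c, map_sum, lp.coeFn_sum, Finset.sum_apply, hAs]
  have hD : ∑ j ∈ Finset.range N, ∑ k ∈ Finset.range N, a (j - k) * ε ^ ((j : ℤ) - k) =
      ∑ j ∈ s, ε ^ j * A c j := by
    simp only [hAc, s, Finset.sum_map, Nat.castEmbedding_apply, Finset.mul_sum]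
    refine Finset.sum_congr rfl fun j _ => Finset.sum_congr rfl fun k _ => ?_
    rw [zpow_sub₀ hε0, div_eq_mul_inv, ← inv_zpow, hinv]
    ring
  rw [hD]
  have hCS : (∑ j ∈ s, ε ^ j * A c j) ^ 2 ≤ (N * ‖A‖) ^ 2 := by
    calc (∑ j ∈ s, ε ^ j * A c j) ^ 2 ≤ (∑ j ∈ s, (ε ^ j) ^ 2) * ∑ j ∈ s, A c j ^ 2 :=
          Finset.sum_mul_sq_le_sq_mul_sq _ _ _
      _ ≤ N * ‖A c‖ ^ 2 := by
          have : ∑ j ∈ s, (ε ^ j) ^ 2 = (N : ℝ) := by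
            rw [Finset.sum_congr rfl fun (j : ℤ) _ => show (ε ^ j) ^ 2 = 1 by rw [← sq_abs, habs, one_pow]]
            simp [hcard]
          rw [this]
          gcongr
          exact lp.sum_sq_le _ _
      _ ≤ N * (‖A‖ * ‖c‖) ^ 2 := by
          gcongr
          exact A.le_opNorm c
      _ = (N * ‖A‖) ^ 2 := by
          rw [mul_pow, hc]
          ring
  have hD' : |∑ j ∈ s, ε ^ j * A c j| ≤ N * ‖A‖ := abs_le_of_sq_le_sq hCS (by positivity)
  rw [abs_mul, abs_inv, Nat.abs_cast]
  rcases Nat.eq_zero_or_pos N with rfl | hN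
  · simp
  · rw [inv_mul_le_iff₀ (by positivity)]
    exact hD'

theorem IsMask.hasToeplitzNorm {a : ℤ → ℝ} (ha : IsMask a) {ε M : ℝ} (hε : |ε| = 1)
    (hM : ∀ z : ℂ, ‖z‖ = 1 → ‖symbol a z‖ ≤ M) (heq : ‖symbol a (ε : ℂ)‖ = M) :
    HasToeplitzNorm a M := by
  obtain ⟨A, hA, hle⟩ := ha.exists_toeplitz (heq ▸ norm_nonneg _) hM
  exact ⟨A, hA, hle.antisymm (heq ▸ ha.le_norm_toeplitz hε A hA)⟩

/-! ### Laurent expansions with exponential decay, and inverses of Laurent polynomials. -/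

theorem summable_pow_natAbs {r : ℝ} (h0 : 0 ≤ r) (h1 : r < 1) :
    Summable fun k : ℤ => r ^ k.natAbs :=
  .of_nat_of_neg (by simpa using summable_geometric_of_lt_one h0 h1)
    (by simpa using summable_geometric_of_lt_one h0 h1)

/-- On the unit circle, `f` is the sum of a Laurent series with exponentially decaying
coefficients. -/
def HasDecayingExpansion (f : ℂ → ℂ) : Prop :=
  ∃ (g : ℤ → ℂ) (K r : ℝ), 0 < r ∧ r < 1 ∧ (∀ k, ‖g k‖ ≤ K * r ^ k.natAbs) ∧
    ∀ z : ℂ, ‖z‖ = 1 → HasSum (fun k => g k * z ^ k) (f z)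

theorem HasDecayingExpansion.congr {f₁ f₂ : ℂ → ℂ} (h : HasDecayingExpansion f₁)
    (heq : ∀ z : ℂ, ‖z‖ = 1 → f₁ z = f₂ z) : HasDecayingExpansion f₂ := by
  obtain ⟨g, K, r, h0, h1, hg, hs⟩ := h
  exact ⟨g, K, r, h0, h1, hg, fun z hz => heq z hz ▸ hs z hz⟩

theorem HasDecayingExpansion.const_mul {f : ℂ → ℂ} (h : HasDecayingExpansion f) (c : ℂ) :
    HasDecayingExpansion fun z => c * f z := by
  obtain ⟨g, K, r, h0, h1, hg, hs⟩ := h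
  refine ⟨fun k => c * g k, ‖c‖ * K, r, h0, h1, fun k => ?_, fun z hz => ?_⟩
  · rw [norm_mul, mul_assoc]
    gcongr
    exact hg k
  · simpa only [mul_assoc] using (hs z hz).mul_left c

theorem HasDecayingExpansion.comp_inv {f : ℂ → ℂ} (h : HasDecayingExpansion f) :
    HasDecayingExpansion fun z => f z⁻¹ := by
  obtain ⟨g, K, r, h0, h1, hg, hs⟩ := h
  refine ⟨fun k => g (-k), K, r, h0, h1, fun k => by simpa using hg (-k), fun z hz => ?_⟩
  have := (Equiv.neg ℤ).hasSum_iff.2 (hs z⁻¹ (by simp [hz]))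
  simpa [Function.comp_def] using this

theorem hasDecayingExpansion_zpow (m : ℤ) : HasDecayingExpansion fun z => z ^ m := by
  refine ⟨fun k => if k = m then 1 else 0, 2 ^ m.natAbs, 1 / 2, by norm_num, by norm_num,
    fun k => ?_, fun z _ => ?_⟩
  · dsimp only
    split_ifs with h
    · subst h
      simp
    · simp only [norm_zero]
      positivity
  · convert! hasSum_ite_eq m (z ^ m) using 2 with k
    split_ifs with h <;> simp [h]

theorem hasDecayingExpansion_inv_one_sub {w : ℂ} (hw : ‖w‖ < 1) :
    HasDecayingExpansion fun z => (1 - w * z)⁻¹ := by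
  -- The maximum with `1 / 2` keeps the ratio positive when `w = 0`.
  refine ⟨fun k => if 0 ≤ k then w ^ k.natAbs else 0, 1, max ‖w‖ (1 / 2), by positivity,
    max_lt hw (by norm_num), fun k => ?_, fun z hz => ?_⟩
  · dsimp only
    split_ifs with h
    · rw [norm_pow, one_mul]
      gcongr
      exact le_max_left _ _
    · simp only [norm_zero]
      positivity
  · have h := hasSum_geometric_of_norm_lt_one (ξ := w * z) (by simpa [hz] using hw)
    rw [← Function.Injective.hasSum_iff (g := ((↑) : ℕ → ℤ)) Nat.cast_injective]
    · convert! h using 2 with n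
      simp [mul_pow]
    · intro k hk
      have : ¬ 0 ≤ k := fun h0 => hk ⟨k.toNat, by simp [h0]⟩
      simp [this]

theorem hasSum_convolution_mul_zpow {a b : ℤ → ℂ} (ha : Summable fun k => ‖a k‖)
    (hb : Summable fun k => ‖b k‖) {z : ℂ} (hz : ‖z‖ = 1) :
    HasSum (fun k => (∑' l, a l * b (k - l)) * z ^ k)
      ((∑' k, a k * z ^ k) * ∑' k, b k * z ^ k) := by
  have hz0 : z ≠ 0 := by
    rintro rfl
    simp at hz
  have ha' : Summable fun k => ‖a k * z ^ k‖ := by simpa [hz] using ha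
  have hb' : Summable fun k => ‖b k * z ^ k‖ := by simpa [hz] using hb
  rw [tsum_mul_tsum_of_summable_norm ha' hb']
  have h := (summable_mul_of_summable_norm ha' hb').hasSum
  let e : ℤ × ℤ ≃ ℤ × ℤ :=
    { toFun := fun p => (p.2, p.1 - p.2)
      invFun := fun p => (p.1 + p.2, p.1)
      left_inv := fun p => by ext <;> simp
      right_inv := fun p => by ext <;> simp }
  have h' := e.hasSum_iff.2 h
  have hterm : ∀ k l : ℤ, a l * z ^ l * (b (k - l) * z ^ (k - l)) = a l * b (k - l) * z ^ k := by
    intro k l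
    rw [zpow_sub₀ hz0]
    field_simp
  convert! h'.prod_fiberwise fun k => (h'.summable.prod_factor k).hasSum using 2 with k
  simp only [Function.comp_def, e, Equiv.coe_fn_mk, hterm, tsum_mul_right]

theorem HasDecayingExpansion.mul {f₁ f₂ : ℂ → ℂ} (h₁ : HasDecayingExpansion f₁)
    (h₂ : HasDecayingExpansion f₂) : HasDecayingExpansion fun z => f₁ z * f₂ z := by
  obtain ⟨g₁, K₁, r₁, h₁0, h₁1, hg₁, hs₁⟩ := h₁
  obtain ⟨g₂, K₂, r₂, h₂0, h₂1, hg₂, hs₂⟩ := h₂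
  have hK₁ : 0 ≤ K₁ := by simpa using (norm_nonneg _).trans (hg₁ 0)
  have hK₂ : 0 ≤ K₂ := by simpa using (norm_nonneg _).trans (hg₂ 0)
  -- The square root leaves room to split the decay: since `|k| ≤ |l| + |k - l|`, each product is at
  -- most a constant times `ρ^|k| ρ^|l|`, and the second factor is summable over `l`.
  let ρ := √(max r₁ r₂)
  have hρ2 : ρ ^ 2 = max r₁ r₂ := Real.sq_sqrt (by positivity)
  have hρ0 : 0 < ρ := Real.sqrt_pos.2 (by positivity)
  have hρ1 : ρ < 1 := (Real.sqrt_lt' one_pos).2 (by simp [*])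
  have hg₁' : ∀ k, ‖g₁ k‖ ≤ K₁ * (ρ ^ 2) ^ k.natAbs := fun k => (hg₁ k).trans (by
    rw [hρ2]
    gcongr
    exact le_max_left _ _)
  have hg₂' : ∀ k, ‖g₂ k‖ ≤ K₂ * (ρ ^ 2) ^ k.natAbs := fun k => (hg₂ k).trans (by
    rw [hρ2]
    gcongr
    exact le_max_right _ _)
  have hW := summable_pow_natAbs hρ0.le hρ1
  have hS : ∀ {g : ℤ → ℂ} {K r : ℝ}, 0 < r → r < 1 → (∀ k, ‖g k‖ ≤ K * r ^ k.natAbs) →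
      Summable fun k => ‖g k‖ := fun h0 h1 h =>
    .of_nonneg_of_le (fun _ => norm_nonneg _) h ((summable_pow_natAbs h0.le h1).mul_left _)
  refine ⟨fun k => ∑' l, g₁ l * g₂ (k - l), K₁ * K₂ * ∑' k : ℤ, ρ ^ k.natAbs, ρ, hρ0, hρ1,
    fun k => ?_, fun z hz => ?_⟩
  · have hle : ∀ l, ‖g₁ l * g₂ (k - l)‖ ≤ K₁ * K₂ * ρ ^ k.natAbs * ρ ^ l.natAbs := by
      intro l
      calc ‖g₁ l * g₂ (k - l)‖ ≤ (K₁ * (ρ ^ 2) ^ l.natAbs) * (K₂ * (ρ ^ 2) ^ (k - l).natAbs) := by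
            rw [norm_mul]
            gcongr
            · exact hg₁' l
            · exact hg₂' _
        _ = K₁ * K₂ * ρ ^ (2 * l.natAbs + 2 * (k - l).natAbs) := by
            rw [pow_add, pow_mul, pow_mul]
            ring
        _ ≤ K₁ * K₂ * ρ ^ (k.natAbs + l.natAbs) := by
            gcongr K₁ * K₂ * ?_
            exact pow_le_pow_of_le_one hρ0.le hρ1.le (by omega)
        _ = K₁ * K₂ * ρ ^ k.natAbs * ρ ^ l.natAbs := by rw [pow_add, mul_assoc]; ring
    calc ‖∑' l, g₁ l * g₂ (k - l)‖ ≤ K₁ * K₂ * ρ ^ k.natAbs * ∑' l : ℤ, ρ ^ l.natAbs :=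
          tsum_of_norm_bounded (hW.hasSum.mul_left _) hle
      _ = _ := by ring
  · beta_reduce
    rw [← (hs₁ z hz).tsum_eq, ← (hs₂ z hz).tsum_eq]
    exact hasSum_convolution_mul_zpow (hS h₁0 h₁1 hg₁) (hS h₂0 h₂1 hg₂) hz

/-- A geometric series in `w / z` if `w` lies inside the circle, in `z / w` if it lies outside. -/
theorem hasDecayingExpansion_inv_sub {w : ℂ} (hw : ‖w‖ ≠ 1) :
    HasDecayingExpansion fun z => (z - w)⁻¹ := by
  have hz0 : ∀ z : ℂ, ‖z‖ = 1 → z ≠ 0 := by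
    rintro _ hz rfl
    simp at hz
  rcases hw.lt_or_gt with h | h
  · refine ((hasDecayingExpansion_zpow (-1)).mul
      (hasDecayingExpansion_inv_one_sub h).comp_inv).congr fun z hz => ?_
    have := hz0 z hz
    rw [zpow_neg_one, ← mul_inv]
    congr 1
    field_simp
  · have hw0 : w ≠ 0 := norm_pos_iff.1 (one_pos.trans h)
    refine ((hasDecayingExpansion_inv_one_sub (w := w⁻¹)
      (by rw [norm_inv]; exact inv_lt_one_of_one_lt₀ h)).const_mul (-w⁻¹)).congr fun z hz => ?_
    rw [neg_mul, ← mul_inv, ← inv_neg]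
    congr 1
    field_simp
    ring

theorem Polynomial.hasDecayingExpansion_inv (P : Polynomial ℂ)
    (hP : ∀ z : ℂ, ‖z‖ = 1 → P.eval z ≠ 0) : HasDecayingExpansion fun z => (P.eval z)⁻¹ := by
  have hprod : ∀ s : Multiset ℂ, (∀ w ∈ s, ‖w‖ ≠ 1) →
      HasDecayingExpansion fun z => ((s.map fun w => z - w).prod)⁻¹ := by
    intro s
    induction s using Multiset.induction_on with
    | empty => exact fun _ => (hasDecayingExpansion_zpow 0).congr fun z _ => by simp
    | cons w s ih =>
      intro h
      refine ((hasDecayingExpansion_inv_sub (h w (by simp))).mul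
        (ih fun v hv => h v (by simp [hv]))).congr fun z _ => ?_
      simp [mul_comm]
  have h := (hprod P.roots fun w hw h1 => hP w h1 (isRoot_of_mem_roots hw)).const_mul
    P.leadingCoeff⁻¹
  refine h.congr fun z _ => ?_
  rw [← mul_inv, ← (IsAlgClosed.splits P).eval_eq_prod_roots]

/-- A finitely supported mask whose symbol has no zero on the unit circle has an exponentially
decaying inverse. -/
theorem exists_isInverseMask_of_finite_support {a : ℤ → ℝ} (ha : (Function.support a).Finite)
    (h0 : ∀ z : ℂ, ‖z‖ = 1 → symbol a z ≠ 0) :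
    ∃ γ : ℤ → ℝ, IsInverseMask a γ ∧ DecaysExponentially γ := by
  have hsym : ∀ z, symbol a z = ∑ k ∈ ha.toFinset, (a k : ℂ) * z ^ k := fun z =>
    tsum_eq_sum fun k hk => by simp_all
  obtain ⟨N, hN⟩ : ∃ N : ℕ, ∀ k ∈ ha.toFinset, 0 ≤ k + N := by
    refine ⟨∑ k ∈ ha.toFinset, k.natAbs, fun k hk => ?_⟩
    have := Finset.single_le_sum (f := Int.natAbs) (fun _ _ => Nat.zero_le _) hk
    omega
  -- Multiplication by `z ^ N` clears the negative powers and does not vanish on the circle.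
  let P : Polynomial ℂ := ∑ k ∈ ha.toFinset, Polynomial.C (a k : ℂ) * Polynomial.X ^ (k + N).toNat
  have hP : ∀ z : ℂ, ‖z‖ = 1 → P.eval z = z ^ (N : ℤ) * symbol a z := by
    intro z hz
    have hz0 : z ≠ 0 := by
      rintro rfl
      simp at hz
    rw [hsym, Polynomial.eval_finsetSum, Finset.mul_sum]
    refine Finset.sum_congr rfl fun k hk => ?_
    rw [Polynomial.eval_mul, Polynomial.eval_C, Polynomial.eval_pow, Polynomial.eval_X,
      ← zpow_natCast, Int.toNat_of_nonneg (hN k hk), zpow_add₀ hz0]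
    ring
  have hne : ∀ z : ℂ, ‖z‖ = 1 → z ^ (N : ℤ) ≠ 0 := fun z hz => zpow_ne_zero _ (by
    rintro rfl
    simp at hz)
  have hexp : HasDecayingExpansion fun z => (symbol a z)⁻¹ := by
    refine ((hasDecayingExpansion_zpow N).mul (P.hasDecayingExpansion_inv fun z hz => ?_)).congr
      fun z hz => ?_
    · rw [hP z hz]
      exact mul_ne_zero (hne z hz) (h0 z hz)
    · rw [hP z hz, mul_inv, mul_inv_cancel_left₀ (hne z hz)]
  obtain ⟨g, K, r, hr0, hr1, hg, hs⟩ := hexp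
  have hdec : ∀ l, |(g l).re| ≤ max K 1 * r ^ l.natAbs := fun l =>
    (Complex.abs_re_le_norm _).trans ((hg l).trans (by
      gcongr
      exact le_max_left _ _))
  refine ⟨fun k => (g k).re, ⟨isMask_of_summable_norm ?_, fun z hz => ?_⟩,
    max K 1, r, by positivity, hr0, hr1, hdec⟩
  · exact .of_nonneg_of_le (fun _ => norm_nonneg _) hdec
      ((summable_pow_natAbs hr0.le hr1).mul_left _)
  -- As `a` is real, the conjugate coefficients expand the same function; averaging the two
  -- expansions shows that the real parts already do.
  · have hconj : HasSum (fun k => (starRingEnd ℂ) (g k) * z ^ k) (symbol a z)⁻¹ := by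
      have h1 := hs ((starRingEnd ℂ) z) (by simpa using hz)
      have h2 := (Complex.hasSum_conj').2 h1
      convert! h2 using 1
      · ext k
        simp
      · beta_reduce
        rw [hsym, hsym, map_inv₀, map_sum]
        simp
    have h3 := ((hs z hz).add hconj).div_const 2
    have h4 : symbol (fun k => (g k).re) z = (symbol a z)⁻¹ := by
      rw [symbol]
      convert! h3.tsum_eq using 1
      · refine tsum_congr fun k => ?_
        rw [← add_mul, Complex.add_conj]
        push_cast
        ring
      · ring
    rw [h4, mul_inv_cancel₀ (h0 z hz)]

/-! ### Inverse masks and even-inverses. -/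

theorem IsInverseMask.unique {a γ₁ γ₂ : ℤ → ℝ} (h₁ : IsInverseMask a γ₁)
    (h₂ : IsInverseMask a γ₂) : γ₁ = γ₂ := by
  refine h₁.1.ext_symbol h₂.1 fun z hz => ?_
  have h := h₁.2 z hz
  exact mul_left_cancel₀ (left_ne_zero_of_mul_eq_one h) (h.trans (h₂.2 z hz).symm)

theorem isMask_of_finite_support {a : ℤ → ℝ} (ha : (Function.support a).Finite) : IsMask a :=
  isMask_of_summable_norm (summable_of_hasFiniteSupport (by
    refine ha.subset fun k hk => ?_
    simpa using hk))

/-- Both sides are masks in `n` with symbol `1`, so the identity of symbols passes to the entries.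
-/
theorem sum_mul_inverse_eq {a γ : ℤ → ℝ} (ha : (Function.support a).Finite)
    (h : IsInverseMask a γ) (n : ℤ) :
    ∑ i ∈ ha.toFinset, a i * γ (n - i) = if n = 0 then 1 else 0 := by
  have ham := (isMask_of_finite_support ha).summable_norm
  have hγ := h.1.summable_norm
  have hmask1 : IsMask fun n => ∑ i ∈ ha.toFinset, a i * γ (n - i) := by
    refine isMask_of_summable_norm (.of_nonneg_of_le (fun _ => norm_nonneg _)
      (fun n => norm_sum_le _ _) (summable_sum fun i _ => ?_))
    simp only [norm_mul]
    exact ((Equiv.subRight i).summable_iff.2 hγ).mul_left _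
  have hmask2 : IsMask fun n => if n = 0 then 1 else 0 :=
    isMask_of_finite_support ((Set.finite_singleton 0).subset fun k => by simp)
  refine congr_fun (hmask1.ext_symbol hmask2 fun z hz => ?_) n
  have h1 := hasSum_convolution_mul_zpow (a := fun k => (a k : ℂ)) (b := fun k => (γ k : ℂ))
    (by simpa using ham) (by simpa using hγ) hz
  have h2 : ∀ k, ∑' l, (a l : ℂ) * (γ (k - l) : ℂ) =
      ((∑ i ∈ ha.toFinset, a i * γ (k - i) : ℝ) : ℂ) := fun k => by
    rw [tsum_eq_sum (s := ha.toFinset) fun l hl => by simp_all]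
    push_cast
    rfl
  simp only [h2] at h1
  rw [symbol, h1.tsum_eq]
  refine (h.2 z hz).trans ?_
  rw [symbol, tsum_eq_single 0 fun k hk => by simp [hk]]
  simp

theorem downsample_subdivide (a c : ℤ → ℝ) :
    downsample (subdivide a c) = convolve (downsample a) c := by
  funext k
  simp only [downsample, subdivide, convolve]
  rw [← (Equiv.subLeft k).tsum_eq]
  exact tsum_congr fun l => by simp [mul_sub]

theorem IsInverseMask.isEvenInverse {a γ : ℤ → ℝ} (ha : (Function.support (downsample a)).Finite)
    (h : IsInverseMask (downsample a) γ) : IsEvenInverse a γ := by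
  refine ⟨h.1, fun c hc => ?_⟩
  obtain ⟨B, hB⟩ := memℓp_infty_iff.1 hc
  have hB' : ∀ k, ‖c k‖ ≤ B := fun k => hB ⟨k, rfl⟩
  have hsub : downsample (c - subdivide a (decimate γ c)) =
      downsample c - downsample (subdivide a (decimate γ c)) := rfl
  rw [hsub, downsample_subdivide, sub_eq_zero]
  funext k
  set d := downsample c
  have hd : ∀ k, ‖d k‖ ≤ B := fun k => hB' _
  have hsum : ∀ i, Summable fun n => downsample a i * γ (n - i) * d (k - n) := fun i => by
    refine .of_norm_bounded (((Equiv.subRight i).summable_iff.2 h.1.summable_norm).mul_left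
      (‖downsample a i‖ * B)) fun n => ?_
    rw [norm_mul, norm_mul, mul_right_comm]
    simp only [Function.comp, Equiv.subRight_apply]
    gcongr
    exact hd _
  have h1 : ∀ i, downsample a i * convolve γ d (k - i) =
      ∑' n, downsample a i * γ (n - i) * d (k - n) := fun i => by
    rw [convolve, ← (Equiv.subRight i).tsum_eq, ← tsum_mul_left]
    exact tsum_congr fun n => by simp [mul_assoc]
  rw [decimate, convolve, tsum_eq_sum (s := ha.toFinset) fun l hl => by simp_all]
  rw [Finset.sum_congr rfl fun i _ => h1 i]
  rw [← Summable.tsum_finsetSum fun i _ => hsum i]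
  simp only [← Finset.sum_mul, sum_mul_inverse_eq ha h]
  rw [tsum_eq_single 0 fun n hn => by simp [hn]]
  simp

/-! ### The truncated binomial series. -/

theorem succ_mul_multichoose_succ (s : ℝ) (j : ℕ) :
    ((j : ℝ) + 1) * Ring.multichoose s (j + 1) = (s + j) * Ring.multichoose s j := by
  have h1 := Ring.factorial_nsmul_multichoose_eq_ascPochhammer s (j + 1)
  have h0 := Ring.factorial_nsmul_multichoose_eq_ascPochhammer s j
  rw [Polynomial.ascPochhammer_smeval_eq_eval] at h0 h1
  rw [ascPochhammer_succ_eval, ← h0, Nat.factorial_succ, nsmul_eq_mul, nsmul_eq_mul] at h1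
  push_cast at h1
  have hj : (j.factorial : ℝ) ≠ 0 := by positivity
  apply mul_left_cancel₀ hj
  linarith

theorem multichoose_nonneg {s : ℝ} (hs : 0 ≤ s) (j : ℕ) : 0 ≤ Ring.multichoose s j := by
  induction j with
  | zero => simp
  | succ j ih =>
    have h := succ_mul_multichoose_succ s j
    refine nonneg_of_mul_nonneg_right (a := (j : ℝ) + 1) ?_ (by positivity)
    rw [h]
    positivity

/-- The Taylor polynomial of degree `ν` of `(1 - y) ^ (-s)` at `0`. -/
noncomputable def truncatedBinomial (s : ℝ) (ν : ℕ) (y : ℝ) : ℝ :=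
  ∑ j ∈ Finset.range (ν + 1), Ring.multichoose s j * y ^ j

theorem truncatedBinomial_zero_right (s : ℝ) (ν : ℕ) : truncatedBinomial s ν 0 = 1 := by
  simp [truncatedBinomial, Finset.sum_range_succ']

theorem truncatedBinomial_pos {s : ℝ} (hs : 0 ≤ s) (ν : ℕ) {y : ℝ} (hy : 0 ≤ y) :
    0 < truncatedBinomial s ν y := by
  rw [truncatedBinomial, Finset.sum_range_succ']
  have : 0 ≤ ∑ k ∈ Finset.range ν, Ring.multichoose s (k + 1) * y ^ (k + 1) :=
    Finset.sum_nonneg fun k _ => mul_nonneg (multichoose_nonneg hs _) (by positivity)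
  simp only [Ring.multichoose_zero_right, pow_zero]
  linarith

/-- The full series satisfies `(1 - y) Q' = s Q`. By the coefficient recurrence, truncation leaves
an error only in degree `ν`. -/
theorem exists_hasDerivAt_truncatedBinomial (s : ℝ) (ν : ℕ) (y : ℝ) :
    ∃ d, HasDerivAt (truncatedBinomial s ν) d y ∧
      (1 - y) * d = s * truncatedBinomial s ν y - (s + ν) * Ring.multichoose s ν * y ^ ν := by
  induction ν with
  | zero =>
    refine ⟨0, ?_, by simp [truncatedBinomial]⟩
    have : truncatedBinomial s 0 = fun _ => 1 := by
      funext y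
      simp [truncatedBinomial]
    rw [this]
    exact hasDerivAt_const _ _
  | succ ν ih =>
    obtain ⟨d, hd, h⟩ := ih
    have hf : ∀ y, truncatedBinomial s (ν + 1) y =
        truncatedBinomial s ν y + Ring.multichoose s (ν + 1) * y ^ (ν + 1) := fun y => by
      rw [truncatedBinomial, Finset.sum_range_succ, truncatedBinomial]
    refine ⟨d + Ring.multichoose s (ν + 1) * (((ν + 1 : ℕ) : ℝ) * y ^ ν), ?_, ?_⟩
    · rw [funext hf]
      exact hd.add ((hasDerivAt_pow (ν + 1) y).const_mul _)
    · rw [hf, mul_add, h]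
      push_cast
      linear_combination (1 - y) * y ^ ν * succ_mul_multichoose_succ s ν +
        y ^ (ν + 1) * succ_mul_multichoose_succ s ν

/-- Passing from `ν` to `ν + 1` doubles either side and adds `C(s + ν, ν + 1)`: on the left this is
the new Taylor coefficient, on the right it is left over by Pascal's rule. -/
theorem two_pow_mul_truncatedBinomial_half (s : ℝ) (ν : ℕ) :
    2 ^ ν * truncatedBinomial s ν (1 / 2) =
      ∑ j ∈ Finset.range (ν + 1), Ring.choose (s + ν) j := by
  induction ν with
  | zero => simp [truncatedBinomial]
  | succ ν ih =>
    have hs : s + ((ν + 1 : ℕ) : ℝ) = s + ν + 1 := by push_cast; ring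
    have hm : Ring.multichoose s (ν + 1) = Ring.choose (s + ν) (ν + 1) := by
      rw [Ring.multichoose_eq]
      congr 1
      push_cast
      ring
    rw [hs, Finset.sum_range_succ']
    simp only [Ring.choose_succ_succ, Finset.sum_add_distrib, Ring.choose_zero_right]
    have h2 := Finset.sum_range_succ' (fun j => Ring.choose (s + (ν : ℝ)) j) (ν + 1)
    rw [Finset.sum_range_succ, ← ih, Ring.choose_zero_right] at h2
    rw [← ih, truncatedBinomial, Finset.sum_range_succ, ← truncatedBinomial, hm, add_assoc, ← h2,
      pow_succ, mul_add]
    have : (2 : ℝ) ^ ν * 2 * (Ring.choose (s + ν) (ν + 1) * (1 / 2) ^ (ν + 1)) =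
        Ring.choose (s + ν) (ν + 1) := by
      rw [one_div, inv_pow, pow_succ]
      field_simp
    rw [this]
    ring

/-! ### Monotonicity of `h(y) + h(1 - y)`. -/

theorem reflected_sum_bounds {h D : ℝ → ℝ} (hh : ∀ y, HasDerivAt h (-D y) y)
    (hD : ∀ y, 0 ≤ y → y ≤ 1 / 2 → D (1 - y) ≤ D y) {y : ℝ} (hy0 : 0 ≤ y) (hy1 : y ≤ 1) :
    2 * h (1 / 2) ≤ h y + h (1 - y) ∧ h y + h (1 - y) ≤ h 0 + h 1 := by
  have hderiv : ∀ y, HasDerivAt (fun y => h y + h (1 - y)) (-D y + D (1 - y)) y := fun y => by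
    have h1 : HasDerivAt (fun y : ℝ => 1 - y) (-1) y := by
      simpa using (hasDerivAt_id y).const_sub 1
    convert! (hh y).add ((hh (1 - y)).comp y h1) using 1
    ring
  have hanti : AntitoneOn (fun y => h y + h (1 - y)) (Set.Icc 0 (1 / 2)) := by
    refine antitoneOn_of_deriv_nonpos (convex_Icc _ _)
      (fun y _ => (hderiv y).continuousAt.continuousWithinAt)
      (fun y _ => (hderiv y).differentiableAt.differentiableWithinAt) fun y hy => ?_
    rw [interior_Icc] at hy
    rw [(hderiv y).deriv]
    linarith [hD y hy.1.le hy.2.le]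
  have key : ∀ y, 0 ≤ y → y ≤ 1 / 2 →
      2 * h (1 / 2) ≤ h y + h (1 - y) ∧ h y + h (1 - y) ≤ h 0 + h 1 := fun y h0 h1 => by
    have ha := hanti ⟨h0, h1⟩ ⟨by norm_num, le_rfl⟩ h1
    have hb := hanti ⟨le_rfl, by norm_num⟩ ⟨h0, h1⟩ h0
    simp only [sub_zero, show (1 : ℝ) - 1 / 2 = 1 / 2 by norm_num] at ha hb
    exact ⟨by linarith, hb⟩
  rcases le_total y (1 / 2) with hy | hy
  · exact key y hy0 hy
  · have := key (1 - y) (by linarith) (by linarith)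
    rwa [sub_sub_cancel, add_comm (h (1 - y))] at this

theorem hasDerivAt_one_sub_pow (n : ℕ) (y : ℝ) :
    HasDerivAt (fun y : ℝ => (1 - y) ^ (n + 1)) (-((n + 1) * (1 - y) ^ n)) y := by
  have h1 : HasDerivAt (fun y : ℝ => 1 - y) (-1) y := by
    simpa using (hasDerivAt_id y).const_sub 1
  convert! h1.pow (n + 1) using 1
  push_cast [Nat.add_sub_cancel]
  ring

theorem pow_mul_pow_one_sub_le {y : ℝ} (h0 : 0 ≤ y) (h1 : y ≤ 1 / 2) {j k : ℕ} (h : j ≤ k) :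
    y ^ k * (1 - y) ^ j ≤ (1 - y) ^ k * y ^ j := by
  obtain ⟨i, rfl⟩ := Nat.exists_eq_add_of_le h
  have hi : y ^ i ≤ (1 - y) ^ i := by
    gcongr
    linarith
  have hy : 0 ≤ 1 - y := by linarith
  calc y ^ (j + i) * (1 - y) ^ j = (y ^ j * (1 - y) ^ j) * y ^ i := by ring
    _ ≤ (y ^ j * (1 - y) ^ j) * (1 - y) ^ i := by gcongr
    _ = (1 - y) ^ (j + i) * y ^ j := by ring

/-- The even-order case of the bounds for the modulus of the even symbol. -/
theorem truncatedBinomial_bounds_even {p ν : ℕ} (h : ν + 1 ≤ p) {y : ℝ} (hy0 : 0 ≤ y)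
    (hy1 : y ≤ 1) :
    2 * ((1 / 2) ^ p * truncatedBinomial p ν (1 / 2)) ≤
        (1 - y) ^ p * truncatedBinomial p ν y + y ^ p * truncatedBinomial p ν (1 - y) ∧
      (1 - y) ^ p * truncatedBinomial p ν y + y ^ p * truncatedBinomial p ν (1 - y) ≤ 1 := by
  obtain ⟨q, rfl⟩ : ∃ q, p = q + 1 := ⟨p - 1, by omega⟩
  set s : ℝ := ((q + 1 : ℕ) : ℝ) with hs
  have hκ : 0 ≤ (s + ν) * Ring.multichoose s ν :=
    mul_nonneg (by positivity) (multichoose_nonneg (by positivity) _)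
  have := reflected_sum_bounds (h := fun y => (1 - y) ^ (q + 1) * truncatedBinomial s ν y)
    (D := fun y => (s + ν) * Ring.multichoose s ν * ((1 - y) ^ q * y ^ ν)) (fun y => ?_)
    (fun y h0 h1 => ?_) hy0 hy1
  · norm_num [truncatedBinomial_zero_right] at this ⊢
    exact this
  · obtain ⟨d, hd, hd'⟩ := exists_hasDerivAt_truncatedBinomial s ν y
    convert! (hasDerivAt_one_sub_pow q y).mul hd using 1
    rw [hs] at hd' ⊢
    push_cast at hd' ⊢
    linear_combination -(1 - y) ^ q * hd'
  -- The restriction on `ν` enters here, as `ν ≤ p - 1 = q`.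
  · have := pow_mul_pow_one_sub_le h0 h1 (Nat.le_of_succ_le_succ h)
    simp only [sub_sub_cancel]
    gcongr

/-- The odd-order case of the bounds for the squared modulus of the even symbol. -/
theorem truncatedBinomial_bounds_odd {n ν : ℕ} (h : 2 * ν + 1 ≤ n) {y : ℝ} (hy0 : 0 ≤ y)
    (hy1 : y ≤ 1) :
    2 * ((1 / 2) ^ n * truncatedBinomial (n / 2) ν (1 / 2) ^ 2) ≤
        (1 - y) ^ n * truncatedBinomial (n / 2) ν y ^ 2 +
          y ^ n * truncatedBinomial (n / 2) ν (1 - y) ^ 2 ∧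
      (1 - y) ^ n * truncatedBinomial (n / 2) ν y ^ 2 +
          y ^ n * truncatedBinomial (n / 2) ν (1 - y) ^ 2 ≤ 1 := by
  obtain ⟨q, rfl⟩ : ∃ q, n = q + 1 := ⟨n - 1, by omega⟩
  set s : ℝ := ((q + 1 : ℕ) : ℝ) / 2 with hs
  have hκ : 0 ≤ 2 * ((s + ν) * Ring.multichoose s ν) :=
    mul_nonneg two_pos.le (mul_nonneg (by positivity) (multichoose_nonneg (by positivity) _))
  have := reflected_sum_bounds (h := fun y => (1 - y) ^ (q + 1) * truncatedBinomial s ν y ^ 2)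
    (D := fun y => 2 * ((s + ν) * Ring.multichoose s ν) *
      ((1 - y) ^ q * y ^ ν * truncatedBinomial s ν y)) (fun y => ?_)
    (fun y h0 h1 => ?_) hy0 hy1
  · norm_num [truncatedBinomial_zero_right] at this ⊢
    exact this
  · obtain ⟨d, hd, hd'⟩ := exists_hasDerivAt_truncatedBinomial s ν y
    convert! (hasDerivAt_one_sub_pow q y).mul (hd.pow 2) using 1
    have hs2 : (q : ℝ) + 1 = 2 * s := by rw [hs]; push_cast; ring
    rw [hs2]
    simp only [Nat.cast_ofNat, Nat.add_one_sub_one, pow_one, Pi.pow_apply]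
    linear_combination -2 * (1 - y) ^ q * truncatedBinomial s ν y * hd'
  · simp only [sub_sub_cancel]
    refine mul_le_mul_of_nonneg_left ?_ hκ
    simp only [truncatedBinomial, Finset.mul_sum]
    -- `D` retains a factor `Q`, so the comparison is termwise: it needs `ν + j ≤ q` for all `j ≤
    -- ν`, which is `2ν ≤ n - 1`.
    refine Finset.sum_le_sum fun j hj => ?_
    have hj' : ν + j ≤ q := by
      have := Finset.mem_range.1 hj
      omega
    have h2 := mul_le_mul_of_nonneg_left (pow_mul_pow_one_sub_le h0 h1 hj')
      (multichoose_nonneg (s := s) (by positivity) j)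
    calc _ = Ring.multichoose s j * (y ^ q * (1 - y) ^ (ν + j)) := by ring
      _ ≤ Ring.multichoose s j * ((1 - y) ^ q * y ^ (ν + j)) := h2
      _ = _ := by ring

/-! ### The pseudo-spline symbol and its even part on the circle. -/

theorem finite_support_coeff (P : ℝ[T;T⁻¹]) : (Function.support fun k => P.coeff k).Finite :=
  P.coeff.hasFiniteSupport

theorem finite_support_downsample {a : ℤ → ℝ} (ha : (Function.support a).Finite) :
    (Function.support (downsample a)).Finite :=
  ha.preimage (f := fun k : ℤ => 2 * k) fun i _ j _ h => by simpa using h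

theorem IsMask.summable_symbol {a : ℤ → ℝ} (ha : IsMask a) {z : ℂ} (hz : ‖z‖ = 1) :
    Summable fun k => (a k : ℂ) * z ^ k :=
  .of_norm (by simpa [hz] using ha.summable_norm)

theorem symbol_coeff (P : ℝ[T;T⁻¹]) (u : ℂˣ) (hu : ‖(u : ℂ)‖ = 1) :
    symbol (fun k => P.coeff k) u = LaurentPolynomial.eval₂ Complex.ofRealHom u P := by
  induction P using LaurentPolynomial.induction_on' with
  | add p q hp hq =>
    rw [map_add, ← hp, ← hq, symbol, symbol, symbol, ← Summable.tsum_add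
      ((isMask_of_finite_support (finite_support_coeff p)).summable_symbol hu)
      ((isMask_of_finite_support (finite_support_coeff q)).summable_symbol hu)]
    refine tsum_congr fun k => ?_
    simp [add_mul]
  | C_mul_T n a =>
    have hcoeff : ∀ k, (LaurentPolynomial.C a * LaurentPolynomial.T n).coeff k =
        if n = k then a else 0 := fun k => by
      rw [← LaurentPolynomial.single_eq_C_mul_T, AddMonoidAlgebra.coeff_single,
        Finsupp.single_apply]
    simp only [LaurentPolynomial.eval₂_C_mul_T, symbol, hcoeff]
    rw [tsum_eq_single n fun k hk => by simp [hk.symm]]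
    simp

theorem symbol_downsample {a : ℤ → ℝ} (ha : IsMask a) {z : ℂ} (hz : ‖z‖ = 1) :
    symbol (downsample a) (z ^ 2) = (symbol a z + symbol a (-z)) / 2 := by
  have h := ((ha.summable_symbol hz).hasSum.add
    (ha.summable_symbol (z := -z) (by simpa using hz)).hasSum).div_const 2
  rw [symbol, symbol, symbol, ← h.tsum_eq]
  have hinj : Function.Injective fun k : ℤ => 2 * k := fun i j h => by simpa using h
  rw [← hinj.tsum_eq (f := fun k => ((a k : ℂ) * z ^ k + (a k : ℂ) * (-z) ^ k) / 2)]
  · refine tsum_congr fun k => ?_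
    simp only [downsample]
    rw [(even_two_mul k).neg_zpow, zpow_mul, zpow_ofNat]
    ring
  · intro k hk
    rcases Int.even_or_odd k with ⟨m, rfl⟩ | hk'
    · exact ⟨m, by ring⟩
    · simp [hk'.neg_zpow] at hk

theorem Complex.norm_exp_mul_I_sq (φ : ℝ) : ‖Complex.exp (φ * Complex.I) ^ 2‖ = 1 := by
  rw [norm_pow, Complex.norm_exp_ofReal_mul_I, one_pow]

theorem finite_support_pseudoSplineMask (n ν : ℕ) :
    (Function.support (pseudoSplineMask n ν)).Finite :=
  finite_support_coeff _

/-- With `e = e^{iφ}` and `z = e²`, one has `1 + z = 2e cos φ` and `1/2 - (z + z⁻¹)/4 = sin² φ`. The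
shift by `⌊n/2⌋` cancels the phase `eⁿ` up to the parity of `n`. -/
theorem symbol_pseudoSplineMask (n ν : ℕ) (φ : ℝ) :
    symbol (pseudoSplineMask n ν) (Complex.exp (φ * Complex.I) ^ 2) =
      2 * Complex.exp (φ * Complex.I) ^ (n % 2) *
        ((Real.cos φ ^ n * truncatedBinomial (n / 2) ν (Real.sin φ ^ 2) : ℝ) : ℂ) := by
  set e := Complex.exp (φ * Complex.I) with he
  have he0 : e ≠ 0 := Complex.exp_ne_zero _
  have hinv : Complex.exp (-φ * Complex.I) = e⁻¹ := by rw [neg_mul, Complex.exp_neg]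
  have hcos : 2 * (Real.cos φ : ℂ) = e + e⁻¹ := by
    rw [Complex.ofReal_cos, Complex.cos, ← he, hinv]
    ring
  have hsin : ((Real.sin φ ^ 2 : ℝ) : ℂ) = 1 / 2 - 1 / 4 * (e ^ 2 + (e ^ 2)⁻¹) := by
    have h1 : (Real.sin φ ^ 2 : ℝ) = 1 - Real.cos φ ^ 2 := by rw [Real.sin_sq]
    have h2 : (Real.cos φ : ℂ) ^ 2 = (e + e⁻¹) ^ 2 / 4 := by
      rw [← hcos]
      ring
    rw [h1, Complex.ofReal_sub, Complex.ofReal_pow, h2, Complex.ofReal_one]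
    field_simp
    ring
  have hu := symbol_coeff (pseudoSplineSymbol n ν) (Units.mk0 (e ^ 2) (pow_ne_zero 2 he0))
    (Complex.norm_exp_mul_I_sq φ)
  rw [Units.val_mk0] at hu
  have hQ : ((truncatedBinomial (n / 2) ν (Real.sin φ ^ 2) : ℝ) : ℂ) =
      ∑ j ∈ Finset.range (ν + 1), ((Ring.choose ((n : ℝ) / 2 + (j : ℝ) - 1) j : ℝ) : ℂ) *
        (1 / 2 - 1 / 4 * (e ^ 2 + (e ^ 2)⁻¹)) ^ j := by
    rw [← hsin, truncatedBinomial]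
    simp only [Ring.multichoose_eq, Complex.ofReal_sum, Complex.ofReal_mul, Complex.ofReal_pow]
  have hmain : (2 : ℂ) ^ (1 - (n : ℤ)) * (e ^ 2) ^ (-((n / 2 : ℕ) : ℤ)) * (1 + e ^ 2) ^ n =
      2 * e ^ (n % 2) * (Real.cos φ : ℂ) ^ n := by
    have h1 : 1 + e ^ 2 = 2 * (Real.cos φ : ℂ) * e := by
      rw [hcos]
      field_simp
      ring
    have h2 : e ^ n = (e ^ 2) ^ (n / 2) * e ^ (n % 2) := by
      rw [← pow_mul, ← pow_add, Nat.div_add_mod]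
    rw [h1, mul_pow, mul_pow, h2, zpow_sub₀ two_ne_zero, zpow_one, zpow_neg, zpow_natCast,
      zpow_natCast]
    field_simp
  have hmask : pseudoSplineMask n ν = fun k => (pseudoSplineSymbol n ν).coeff k := rfl
  rw [hmask, hu, pseudoSplineSymbol, Complex.ofReal_mul, hQ, ← mul_assoc,
    Complex.ofReal_pow, ← hmain]
  simp [map_sum]

theorem symbol_downsample_pseudoSplineMask (n ν : ℕ) (φ : ℝ) :
    symbol (downsample (pseudoSplineMask n ν)) (Complex.exp (φ * Complex.I) ^ 4) =
      Complex.exp (φ * Complex.I) ^ (n % 2) *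
        ((Real.cos φ ^ n * truncatedBinomial (n / 2) ν (Real.sin φ ^ 2) : ℝ) +
          Complex.I ^ (n % 2) *
            (((-Real.sin φ) ^ n * truncatedBinomial (n / 2) ν (Real.cos φ ^ 2) : ℝ) : ℂ)) := by
  have h := symbol_pseudoSplineMask n ν (φ + Real.pi / 2)
  have he : Complex.exp (((φ + Real.pi / 2 : ℝ) : ℂ) * Complex.I) =
      Complex.exp (φ * Complex.I) * Complex.I := by
    push_cast
    rw [add_mul, Complex.exp_add, Complex.exp_pi_div_two_mul_I]
  rw [he, mul_pow, Complex.I_sq, mul_neg_one, Real.cos_add_pi_div_two, Real.sin_add_pi_div_two] at h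
  rw [show Complex.exp (φ * Complex.I) ^ 4 = (Complex.exp (φ * Complex.I) ^ 2) ^ 2 by ring,
    symbol_downsample (isMask_of_finite_support (finite_support_pseudoSplineMask n ν))
      (Complex.norm_exp_mul_I_sq φ), h, symbol_pseudoSplineMask, mul_pow]
  ring

theorem norm_symbol_downsample_even (p ν : ℕ) (φ : ℝ) :
    ‖symbol (downsample (pseudoSplineMask (2 * p) ν)) (Complex.exp (φ * Complex.I) ^ 4)‖ =
      (1 - Real.sin φ ^ 2) ^ p * truncatedBinomial p ν (Real.sin φ ^ 2) +
        (Real.sin φ ^ 2) ^ p * truncatedBinomial p ν (1 - Real.sin φ ^ 2) := by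
  have hp : ((2 * p : ℕ) : ℝ) / 2 = p := by push_cast; ring
  rw [symbol_downsample_pseudoSplineMask, hp, Nat.mul_mod_right, pow_zero, pow_zero, one_mul,
    one_mul, ← Complex.ofReal_add, Complex.norm_real, pow_mul, pow_mul, neg_sq, Real.cos_sq',
    Real.norm_of_nonneg]
  have h1 := Real.sin_sq_le_one φ
  have hs : (0 : ℝ) ≤ 1 - Real.sin φ ^ 2 := by linarith
  have := truncatedBinomial_pos (s := p) (by positivity) ν hs
  have := truncatedBinomial_pos (s := p) (by positivity) ν (sq_nonneg (Real.sin φ))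
  positivity

theorem norm_sq_symbol_downsample_odd {n : ℕ} (hn : n % 2 = 1) (ν : ℕ) (φ : ℝ) :
    ‖symbol (downsample (pseudoSplineMask n ν)) (Complex.exp (φ * Complex.I) ^ 4)‖ ^ 2 =
      (1 - Real.sin φ ^ 2) ^ n * truncatedBinomial (n / 2) ν (Real.sin φ ^ 2) ^ 2 +
        (Real.sin φ ^ 2) ^ n * truncatedBinomial (n / 2) ν (1 - Real.sin φ ^ 2) ^ 2 := by
  rw [symbol_downsample_pseudoSplineMask, hn, pow_one, pow_one, norm_mul,
    Complex.norm_exp_ofReal_mul_I, one_mul, mul_comm Complex.I, Complex.sq_norm,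
    Complex.normSq_add_mul_I, mul_pow, mul_pow, ← pow_mul, ← pow_mul, mul_comm n 2, pow_mul,
    pow_mul, neg_sq, Real.cos_sq']

theorem Complex.exists_exp_mul_I_pow_four {z : ℂ} (hz : ‖z‖ = 1) :
    ∃ φ : ℝ, z = Complex.exp (φ * Complex.I) ^ 4 := by
  refine ⟨z.arg / 4, ?_⟩
  rw [← Complex.exp_nat_mul]
  conv_lhs => rw [← Complex.norm_mul_exp_arg_mul_I z, hz]
  push_cast
  rw [one_mul]
  congr 1
  ring

/-- Both terms of the (squared) modulus are nonnegative and `Q > 0`, so they could vanish together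
only if `sin φ = cos φ = 0`. No bound on `ν` is needed, which is what lets splines of every order be
covered. -/
theorem isEvenReversible_pseudoSplineMask (n ν : ℕ) :
    IsEvenReversible (pseudoSplineMask n ν) := by
  intro z hz
  obtain ⟨φ, rfl⟩ := Complex.exists_exp_mul_I_pow_four hz
  rw [← norm_pos_iff]
  have h1 := Real.sin_sq_le_one φ
  have h0 := sq_nonneg (Real.sin φ)
  rcases Nat.even_or_odd' n with ⟨p, rfl | rfl⟩
  · rw [norm_symbol_downsample_even]
    have h3 := truncatedBinomial_pos (s := p) (by positivity) ν (sub_nonneg.2 h1)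
    have h4 := truncatedBinomial_pos (s := p) (by positivity) ν h0
    rcases h0.eq_or_lt with h | h
    · rw [← h] at h3 h4 ⊢
      simp only [sub_zero, one_pow, one_mul] at h3 h4 ⊢
      positivity
    · have := sub_nonneg.2 h1
      positivity
  · refine lt_of_pow_lt_pow_left₀ 2 (norm_nonneg _) ?_
    rw [norm_sq_symbol_downsample_odd (by omega), zero_pow two_ne_zero]
    have h3 := truncatedBinomial_pos (s := (2 * p + 1 : ℕ) / 2) (by positivity) ν (sub_nonneg.2 h1)
    have h4 := truncatedBinomial_pos (s := (2 * p + 1 : ℕ) / 2) (by positivity) ν h0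
    rcases h0.eq_or_lt with h | h
    · rw [← h] at h3 h4 ⊢
      simp only [sub_zero, one_pow, one_mul] at h3 h4 ⊢
      positivity
    · have := sub_nonneg.2 h1
      positivity

/-! ### Splines as the case `ν = 0`; extreme values of the even symbol; the theorem. -/

theorem splineMask_eq (m : ℕ) : splineMask m = pseudoSplineMask m 0 := by
  funext k
  simp [splineMask, pseudoSplineMask, pseudoSplineSymbol]

/-- The minimal modulus of the even symbol of the pseudo-spline mask. -/
noncomputable def pseudoSplineMin (n ν : ℕ) : ℝ :=
  (∑ j ∈ Finset.range (ν + 1), Ring.choose ((n : ℝ) / 2 + (ν : ℝ)) j) / 2 ^ ((n - 1) / 2 + ν)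

theorem pseudoSplineMin_eq (n ν : ℕ) :
    pseudoSplineMin n ν = (1 / 2) ^ ((n - 1) / 2) * truncatedBinomial (n / 2) ν (1 / 2) := by
  rw [pseudoSplineMin, ← two_pow_mul_truncatedBinomial_half, pow_add, one_div_pow]
  field_simp

theorem pseudoSplineMin_pos (n ν : ℕ) : 0 < pseudoSplineMin n ν := by
  rw [pseudoSplineMin_eq]
  have := truncatedBinomial_pos (s := n / 2) (by positivity) ν (y := 1 / 2) (by norm_num)
  positivity

theorem pseudoSplineMin_even {p : ℕ} (hp : 1 ≤ p) (ν : ℕ) :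
    pseudoSplineMin (2 * p) ν = 2 * ((1 / 2) ^ p * truncatedBinomial p ν (1 / 2)) := by
  obtain ⟨q, rfl⟩ : ∃ q, p = q + 1 := ⟨p - 1, by omega⟩
  have hq : (2 * (q + 1) - 1) / 2 = q := by omega
  have hs : ((2 * (q + 1) : ℕ) : ℝ) / 2 = ((q + 1 : ℕ) : ℝ) := by push_cast; ring
  rw [pseudoSplineMin_eq, hq, hs]
  ring

theorem sq_pseudoSplineMin_odd {n : ℕ} (hn : n % 2 = 1) (ν : ℕ) :
    pseudoSplineMin n ν ^ 2 = 2 * ((1 / 2) ^ n * truncatedBinomial (n / 2) ν (1 / 2) ^ 2) := by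
  have h : (1 / 2 : ℝ) ^ n = ((1 / 2) ^ ((n - 1) / 2)) ^ 2 * (1 / 2) := by
    rw [← pow_mul, ← pow_succ]
    congr 1
    omega
  rw [pseudoSplineMin_eq, mul_pow, h]
  ring

theorem norm_symbol_downsample_bounds {n ν : ℕ} (h : ν + 1 ≤ n / 2) {z : ℂ} (hz : ‖z‖ = 1) :
    pseudoSplineMin n ν ≤ ‖symbol (downsample (pseudoSplineMask n ν)) z‖ ∧
      ‖symbol (downsample (pseudoSplineMask n ν)) z‖ ≤ 1 := by
  obtain ⟨φ, rfl⟩ := Complex.exists_exp_mul_I_pow_four hz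
  have h1 := Real.sin_sq_le_one φ
  have h0 := sq_nonneg (Real.sin φ)
  rcases Nat.mod_two_eq_zero_or_one n with hn | hn
  · obtain ⟨p, rfl⟩ := Nat.dvd_of_mod_eq_zero hn
    rw [norm_symbol_downsample_even, pseudoSplineMin_even (by omega)]
    exact truncatedBinomial_bounds_even (by omega) h0 h1
  · have hb := truncatedBinomial_bounds_odd (n := n) (ν := ν) (by omega) h0 h1
    rw [← norm_sq_symbol_downsample_odd hn, ← sq_pseudoSplineMin_odd hn] at hb
    exact ⟨le_of_sq_le_sq hb.1 (norm_nonneg _), (sq_le_one_iff₀ (norm_nonneg _)).1 hb.2⟩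

theorem symbol_downsample_pseudoSplineMask_one {n : ℕ} (hn : n ≠ 0) (ν : ℕ) :
    symbol (downsample (pseudoSplineMask n ν)) 1 = 1 := by
  have h := symbol_downsample_pseudoSplineMask n ν 0
  simpa [truncatedBinomial_zero_right, hn] using h

theorem norm_symbol_downsample_neg_one {n ν : ℕ} (h : 2 ≤ n) :
    ‖symbol (downsample (pseudoSplineMask n ν)) (-1)‖ = pseudoSplineMin n ν := by
  -- `φ = π/4` is the parameter with `sin² φ = 1/2`, the midpoint of the reflection.
  have he : Complex.exp ((Real.pi / 4 : ℝ) * Complex.I) ^ 4 = -1 := by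
    rw [← Complex.exp_nat_mul, ← Complex.exp_pi_mul_I]
    push_cast
    congr 1
    ring
  have hs : Real.sin (Real.pi / 4) ^ 2 = 1 / 2 := by
    rw [Real.sin_pi_div_four, div_pow, Real.sq_sqrt (by norm_num)]
    norm_num
  have hs' : (1 : ℝ) - 1 / 2 = 1 / 2 := by norm_num
  rw [← he]
  rcases Nat.mod_two_eq_zero_or_one n with hn | hn
  · obtain ⟨p, rfl⟩ := Nat.dvd_of_mod_eq_zero hn
    rw [norm_symbol_downsample_even, pseudoSplineMin_even (by omega), hs, hs']
    ring
  · rw [← sq_eq_sq₀ (norm_nonneg _) (pseudoSplineMin_pos n ν).le,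
      norm_sq_symbol_downsample_odd hn, sq_pseudoSplineMin_odd hn, hs, hs']
    ring

theorem mainTheorem3 :
    (∀ n ν : ℕ, ν + 1 ≤ n / 2 →
      (symbol (downsample (pseudoSplineMask n ν)) 1 = 1 ∧
        HasToeplitzNorm (downsample (pseudoSplineMask n ν)) 1 ∧
        IsGreatest {t : ℝ | ∃ z : ℂ, ‖z‖ = 1 ∧
          t = ‖symbol (downsample (pseudoSplineMask n ν)) z‖} 1) ∧
      (∃! γ : ℤ → ℝ, IsInverseMask (downsample (pseudoSplineMask n ν)) γ) ∧
      (∀ γ : ℤ → ℝ, IsInverseMask (downsample (pseudoSplineMask n ν)) γ →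
        symbol γ 1 = 1 ∧
        HasToeplitzNorm γ
          ((2 : ℝ) ^ ((n - 1) / 2 + ν) /
            ∑ j ∈ Finset.range (ν + 1), Ring.choose ((n : ℝ) / 2 + (ν : ℝ)) j) ∧
        DecaysExponentially γ ∧
        IsEvenInverse (pseudoSplineMask n ν) γ) ∧
      IsEvenReversible (pseudoSplineMask n ν)) ∧
    (∀ m : ℕ, 1 ≤ m →
      IsEvenReversible (splineMask m) ∧ ∃ γ : ℤ → ℝ, IsEvenInverse (splineMask m) γ) := by
  have hfin : ∀ n ν, (Function.support (downsample (pseudoSplineMask n ν))).Finite := fun n ν =>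
    finite_support_downsample (finite_support_pseudoSplineMask n ν)
  have hinv : ∀ n ν, ∃ γ, IsInverseMask (downsample (pseudoSplineMask n ν)) γ ∧
      DecaysExponentially γ := fun n ν =>
    exists_isInverseMask_of_finite_support (hfin n ν) (isEvenReversible_pseudoSplineMask n ν)
  refine ⟨fun n ν h => ?_, fun m _ => ?_⟩
  · have hone := symbol_downsample_pseudoSplineMask_one (n := n) (by omega) ν
    obtain ⟨γ₀, hγ₀, hdec⟩ := hinv n ν
    refine ⟨⟨hone, ?_, ⟨1, by simp, by simp [hone]⟩, ?_⟩,
      ⟨γ₀, hγ₀, fun γ hγ => hγ.unique hγ₀⟩, fun γ hγ => ⟨?_, ?_, hγ.unique hγ₀ ▸ hdec,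
        hγ.isEvenInverse (hfin n ν)⟩, isEvenReversible_pseudoSplineMask n ν⟩
    · exact (isMask_of_finite_support (hfin n ν)).hasToeplitzNorm (ε := 1) (by simp)
        (fun z hz => (norm_symbol_downsample_bounds h hz).2) (by simp [hone])
    · rintro t ⟨z, hz, rfl⟩
      exact (norm_symbol_downsample_bounds h hz).2
    · simpa [hone] using hγ.2 1 (by simp)
    · have hnorm : ∀ z : ℂ, ‖z‖ = 1 →
          ‖symbol γ z‖ = ‖symbol (downsample (pseudoSplineMask n ν)) z‖⁻¹ := fun z hz => by
        rw [← norm_inv, eq_inv_of_mul_eq_one_right (hγ.2 z hz)]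
      have hM : (2 : ℝ) ^ ((n - 1) / 2 + ν) /
          ∑ j ∈ Finset.range (ν + 1), Ring.choose ((n : ℝ) / 2 + (ν : ℝ)) j =
            (pseudoSplineMin n ν)⁻¹ := by rw [pseudoSplineMin, inv_div]
      rw [hM]
      -- The symbol of `γ` is largest where the even symbol is smallest, at `z = -1`.
      refine hγ.1.hasToeplitzNorm (ε := -1) (by simp) (fun z hz => ?_) ?_
      · rw [hnorm z hz]
        exact inv_anti₀ (pseudoSplineMin_pos n ν) (norm_symbol_downsample_bounds h hz).1
      · rw [Complex.ofReal_neg, Complex.ofReal_one, hnorm _ (by simp),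
          norm_symbol_downsample_neg_one (by omega)]
  · rw [splineMask_eq]
    obtain ⟨γ, hγ, -⟩ := hinv m 0
    exact ⟨isEvenReversible_pseudoSplineMask m 0, γ, hγ.isEvenInverse (hfin m 0)⟩
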